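/- Let $X$ be a Tychonoff (completely regular Hausdorff) space and let $C(X)$ be the set of all continuous real-valued functions on $X$. For a family $\lambda$ of nonempty subsets of $X$, let $C_\lambda(X)$ denote $C(X)$ with the $\lambda$-open topology, i.e. the topology with subbase $$[F,U]=\{f\in C(X): f(F)\subseteq U\},\qquad F\in\lambda,\ U\subseteq\mathbb{R}\ \text{open}.$$ Let $\lambda$ be any one of the following families: $MC(X)$, $K(X)$, $SC(X)$, $CC(X)$, $PS(X)$, $RC(X)$, consisting respectively of all nonempty subsets $A$ of $X$ that are metrizable compact, compact, sequentially compact, countably compact, pseudocompact (every continuous real-valued function on the subspace $A$ is bounded), and $C$-compact in $X$ ($f(A)$ is compact for every $f\in C(X)$). Then the following statements are equivalent. 1. $C_\lambda(X)$ contains a dense subspace which has a countable $\pi$-base. 2. $C_\lambda(X)$ has a countable $\pi$-base. 3. $C_\lambda(X)$ is second countable. 4. $X$ is hemicompact and an $\aleph_0$-space. Here a $\pi$-base of a space $Y$ is a family of nonempty open sets such that every nonempty open subset of $Y$ contains a member of the family; $X$ is hemicompact if there is a sequence of compact sets in $X$ such that every compact subset of $X$ is contained in one of them; and $X$ is an $\aleph_0$-space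 if it is regular Hausdorff and has a countable family $\mathcal{N}$ of subsets such that whenever $C\subseteq U$ with $C$ compact and $U$ open in $X$, there is a finite $\mathcal{F}\subseteq\mathcal{N}$ with $C\subseteq\bigcup\mathcal{F}\subseteq U$. -/

import Mathlib

/-- The set `C(X)` of all continuous real-valued functions on `X`, as the underlying set of the
space `C_lam(X)`. This is a separate type, so that it does not carry the compact-open topology that
Mathlib puts on `C(X, ℝ)`. -/
def SetOpenFun (X : Type*) [TopologicalSpace X] (_lam : Set (Set X)) : Type _ := C(X, ℝ)

/-- The set `[F, U]` of all `f ∈ C(X)` with `f(F) ⊆ U`. -/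
def subbasicSet {X : Type*} [TopologicalSpace X] (lam : Set (Set X)) (F : Set X) (U : Set ℝ) :
    Set (SetOpenFun X lam) :=
  {f : C(X, ℝ) | f '' F ⊆ U}

/-- The `lam`-open topology on `C(X)`: the sets `[F, U]` with `F ∈ lam` and `U` open in the real
line form a subbase. -/
instance SetOpenFun.instTopologicalSpace (X : Type*) [TopologicalSpace X] (lam : Set (Set X)) :
    TopologicalSpace (SetOpenFun X lam) :=
  TopologicalSpace.generateFrom
    {W | ∃ F ∈ lam, ∃ U : Set ℝ, IsOpen U ∧ W = subbasicSet lam F U}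

/-- `MC(X)`: the nonempty metrizable compact subsets of `X`. -/
def familyMC (X : Type*) [TopologicalSpace X] : Set (Set X) :=
  {A | A.Nonempty ∧ IsCompact A ∧ TopologicalSpace.MetrizableSpace A}

/-- `K(X)`: the nonempty compact subsets of `X`. -/
def familyK (X : Type*) [TopologicalSpace X] : Set (Set X) :=
  {A | A.Nonempty ∧ IsCompact A}

/-- `SC(X)`: the nonempty sequentially compact subsets of `X`. -/
def familySC (X : Type*) [TopologicalSpace X] : Set (Set X) :=
  {A | A.Nonempty ∧ IsSeqCompact A}

/-- `CC(X)`: the nonempty countably compact subsets of `X`. -/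
def familyCC (X : Type*) [TopologicalSpace X] : Set (Set X) :=
  {A | A.Nonempty ∧ IsCountablyCompact A}

/-- A subset `A` is pseudocompact if every continuous real-valued function on the subspace `A` is
bounded. -/
def IsPseudocompactSet {X : Type*} [TopologicalSpace X] (A : Set X) : Prop :=
  ∀ f : C(A, ℝ), Bornology.IsBounded (Set.range f)

/-- `PS(X)`: the nonempty pseudocompact subsets of `X`. -/
def familyPS (X : Type*) [TopologicalSpace X] : Set (Set X) :=
  {A | A.Nonempty ∧ IsPseudocompactSet A}

/-- A subset `A` is `C`-compact in `X` if `f(A)` is compact for every continuous real-valued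
function `f` on the whole space `X`. -/
def IsCCompactSet {X : Type*} [TopologicalSpace X] (A : Set X) : Prop :=
  ∀ f : C(X, ℝ), IsCompact (f '' A)

/-- `RC(X)`: the nonempty `C`-compact subsets of `X`. -/
def familyRC (X : Type*) [TopologicalSpace X] : Set (Set X) :=
  {A | A.Nonempty ∧ IsCCompactSet A}

/-- A family of nonempty open sets is a `π`-base of `Y` if every nonempty open set of `Y` contains
a member of the family. -/
def IsPiBase {Y : Type*} [TopologicalSpace Y] (B : Set (Set Y)) : Prop :=
  (∀ V ∈ B, IsOpen V ∧ V.Nonempty) ∧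
    ∀ U : Set Y, IsOpen U → U.Nonempty → ∃ V ∈ B, V ⊆ U

/-- The space `Y` has a countable `π`-base. -/
def HasCountablePiBase (Y : Type*) [TopologicalSpace Y] : Prop :=
  ∃ B : Set (Set Y), B.Countable ∧ IsPiBase B

/-- The space `X` is hemicompact: there is a sequence of compact sets such that every compact set
is contained in one of them. -/
def IsHemicompact (X : Type*) [TopologicalSpace X] : Prop :=
  ∃ K : ℕ → Set X, (∀ n, IsCompact (K n)) ∧ ∀ C : Set X, IsCompact C → ∃ n, C ⊆ K n

/-- A family `N` of subsets of `X` is a `k`-network if, whenever a compact set `C` is contained in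
an open set `U`, some finite union of members of `N` lies between `C` and `U`. -/
def IsKNetwork {X : Type*} [TopologicalSpace X] (N : Set (Set X)) : Prop :=
  ∀ C U : Set X, IsCompact C → IsOpen U → C ⊆ U →
    ∃ F : Set (Set X), F ⊆ N ∧ F.Finite ∧ C ⊆ ⋃₀ F ∧ ⋃₀ F ⊆ U

/-- An `ℵ₀`-space: a regular Hausdorff space with a countable `k`-network. -/
def IsAlephZeroSpace (X : Type*) [TopologicalSpace X] : Prop :=
  T3Space X ∧ ∃ N : Set (Set X), N.Countable ∧ IsKNetwork N

open Set Filter Topology TopologicalSpace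

/-! All six families lie between `familyMC X` and `familyRC X`, and singletons belong to each. This
makes the topology regular, so a countable π-base of a dense subspace extends to the whole space.
One function chosen from each member of a countable π-base gives countably many functions separating
the points of X. Then C-compact sets are compact and compact sets are metrizable, so every family
equals `familyK X` and the topology is the compact-open one. A π-base member restricts some function
only on a compact set, which yields hemicompactness; the points where all functions of a member are
positive yield a k-network. Conversely, Urysohn functions for pairs from a countable k-network
separate points, so the families coincide again, and hemicompactness embeds the function space in a
countable product of second countable spaces `C(K n, ℝ)`. -/

/-- The identity of `C(X, ℝ)`, regarded as a bijection onto the space `C_lam(X)`. -/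
def SetOpenFun.of {X : Type*} [TopologicalSpace X] (lam : Set (Set X)) :
    C(X, ℝ) ≃ SetOpenFun X lam :=
  Equiv.refl _

/-! ### Regularity and compact supports in set-open topologies -/

section SetOpen

variable {X : Type*} [TopologicalSpace X] {lam : Set (Set X)}

theorem of_mem_subbasicSet {F : Set X} {U : Set ℝ} {f : C(X, ℝ)} :
    SetOpenFun.of lam f ∈ subbasicSet lam F U ↔ ∀ x ∈ F, f x ∈ U :=
  image_subset_iff

theorem isOpen_subbasicSet {F : Set X} (hF : F ∈ lam) {U : Set ℝ} (hU : IsOpen U) :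
    IsOpen (subbasicSet lam F U) :=
  isOpen_generateFrom_of_mem ⟨F, hF, U, hU, rfl⟩

theorem continuous_setOpenFun_eval {x : X} (hx : {x} ∈ lam) :
    Continuous fun f : SetOpenFun X lam => (SetOpenFun.of lam).symm f x := by
  refine continuous_def.2 fun U hU => ?_
  convert isOpen_subbasicSet hx hU using 1
  ext f
  obtain ⟨f, rfl⟩ := (SetOpenFun.of lam).surjective f
  simp [of_mem_subbasicSet]

theorem isClosed_subbasicSet (hpt : ∀ x : X, {x} ∈ lam) (F : Set X) {U : Set ℝ}
    (hU : IsClosed U) : IsClosed (subbasicSet lam F U) := by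
  have : subbasicSet lam F U =
      ⋂ x ∈ F, (fun f : SetOpenFun X lam => (SetOpenFun.of lam).symm f x) ⁻¹' U := by
    ext f
    obtain ⟨f, rfl⟩ := (SetOpenFun.of lam).surjective f
    simp [of_mem_subbasicSet]
  rw [this]
  exact isClosed_biInter fun x _ => hU.preimage (continuous_setOpenFun_eval (hpt x))

/-- The `lam`-open topology is regular when `lam` consists of `C`-compact sets and contains the
singletons. -/
theorem regularSpace_setOpenFun (hpt : ∀ x : X, {x} ∈ lam) (hRC : lam ⊆ familyRC X) :
    RegularSpace (SetOpenFun X lam) := by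
  have key : ∀ W : Set (SetOpenFun X lam), IsOpen W →
      ∀ f ∈ W, ∃ t ∈ 𝓝 f, IsClosed t ∧ t ⊆ W := by
    intro W hW
    induction hW with
    | basic s hs =>
      obtain ⟨F, hF, U, hU, rfl⟩ := hs
      intro f hf
      obtain ⟨f, rfl⟩ := (SetOpenFun.of lam).surjective f
      obtain ⟨V, hVo, hfV, hVU, -⟩ := exists_open_between_and_isCompact_closure
        ((hRC hF).2 f) hU (image_subset_iff.2 (of_mem_subbasicSet.1 hf))
      refine ⟨subbasicSet lam F (closure V), ?_, isClosed_subbasicSet hpt F isClosed_closure,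
        fun g hg => Subset.trans hg hVU⟩
      exact mem_of_superset ((isOpen_subbasicSet hF hVo).mem_nhds hfV)
        fun g hg => Subset.trans hg subset_closure
    | univ => exact fun f _ => ⟨univ, univ_mem, isClosed_univ, Subset.rfl⟩
    | inter s t _ _ hs ht =>
      rintro f ⟨hfs, hft⟩
      obtain ⟨a, ha, hac, has⟩ := hs f hfs
      obtain ⟨b, hb, hbc, hbt⟩ := ht f hft
      exact ⟨a ∩ b, inter_mem ha hb, hac.inter hbc, inter_subset_inter has hbt⟩
    | sUnion S _ ih =>
      rintro f ⟨s, hs, hfs⟩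
      obtain ⟨a, ha, hac, has⟩ := ih s hs f hfs
      exact ⟨a, ha, hac, has.trans (subset_sUnion_of_mem hs)⟩
  refine .of_exists_mem_nhds_isClosed_subset fun f s hs => ?_
  obtain ⟨W, hWs, hW, hfW⟩ := mem_nhds_iff.1 hs
  obtain ⟨t, ht, htc, htW⟩ := key W hW f hfW
  exact ⟨t, ht, htc, htW.trans hWs⟩

/-- A neighbourhood of `f` in the `lam`-open topology constrains functions only on a compact set,
when `lam` consists of compact sets. -/
theorem exists_compact_support (hK : ∀ F ∈ lam, IsCompact F) {W : Set (SetOpenFun X lam)}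
    (hW : IsOpen W) : ∀ f : C(X, ℝ), SetOpenFun.of lam f ∈ W →
      ∃ K : Set X, IsCompact K ∧ ∀ g : C(X, ℝ), EqOn g f K → SetOpenFun.of lam g ∈ W := by
  induction hW with
  | basic s hs =>
    obtain ⟨F, hF, U, hU, rfl⟩ := hs
    intro f hf
    refine ⟨F, hK F hF, fun g hg => of_mem_subbasicSet.2 fun x hx => ?_⟩
    rw [hg hx]
    exact of_mem_subbasicSet.1 hf x hx
  | univ => exact fun f _ => ⟨∅, isCompact_empty, fun _ _ => mem_univ _⟩
  | inter s t _ _ hs ht =>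
    rintro f ⟨hfs, hft⟩
    obtain ⟨a, ha, has⟩ := hs f hfs
    obtain ⟨b, hb, hbt⟩ := ht f hft
    exact ⟨a ∪ b, ha.union hb, fun g hg =>
      ⟨has g (hg.mono subset_union_left), hbt g (hg.mono subset_union_right)⟩⟩
  | sUnion S _ ih =>
    rintro f ⟨s, hs, hfs⟩
    obtain ⟨a, ha, has⟩ := ih s hs f hfs
    exact ⟨a, ha, fun g hg => ⟨s, hs, has g hg⟩⟩

end SetOpen

/-! ### Countable π-bases and dense subspaces -/

section PiBase

variable {Y : Type*} [TopologicalSpace Y]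

/-- Each member is extended to an open set of Y. The trace on D is dense in that open set, so a
closed set containing the trace contains the whole extension; regularity supplies such closed sets.
-/
theorem HasCountablePiBase.of_dense [RegularSpace Y] {D : Set Y} (hD : Dense D)
    (h : HasCountablePiBase D) : HasCountablePiBase Y := by
  obtain ⟨B, hBc, hB, hBU⟩ := h
  choose! W hWo hWV using fun V (hV : V ∈ B) => isOpen_induced_iff.1 (hB V hV).1
  refine ⟨W '' B, hBc.image W, ?_, fun U hU ⟨y, hy⟩ => ?_⟩
  · rintro _ ⟨V, hV, rfl⟩
    obtain ⟨d, hd⟩ := (hB V hV).2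
    rw [← hWV V hV] at hd
    exact ⟨hWo V hV, d, hd⟩
  · obtain ⟨t, ht, htc, htU⟩ := exists_mem_nhds_isClosed_subset (hU.mem_nhds hy)
    obtain ⟨d, hdt, hdD⟩ := hD.inter_open_nonempty (interior t) isOpen_interior
      ⟨y, mem_interior_iff_mem_nhds.2 ht⟩
    obtain ⟨V, hV, hVt⟩ := hBU (Subtype.val ⁻¹' interior t)
      (isOpen_interior.preimage continuous_subtype_val) ⟨⟨d, hdD⟩, hdt⟩
    refine ⟨W V, mem_image_of_mem W hV, ?_⟩
    calc W V ⊆ closure (W V ∩ D) := hD.open_subset_closure_inter (hWo V hV)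
      _ ⊆ t := closure_minimal (fun z hz => interior_subset
        (hVt ((Set.ext_iff.1 (hWV V hV) ⟨z, hz.2⟩).1 hz.1))) htc
      _ ⊆ U := htU

theorem HasCountablePiBase.of_secondCountable [SecondCountableTopology Y] :
    HasCountablePiBase Y := by
  refine ⟨countableBasis Y, countable_countableBasis Y, fun V hV =>
    ⟨isOpen_of_mem_countableBasis hV, nonempty_of_mem_countableBasis hV⟩, fun U hU ⟨y, hy⟩ => ?_⟩
  obtain ⟨V, hV, -, hVU⟩ := (isBasis_countableBasis Y).exists_subset_of_mem_open hy hU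
  exact ⟨V, hV, hVU⟩

theorem HasCountablePiBase.restrict_univ (h : HasCountablePiBase Y) :
    HasCountablePiBase (univ : Set Y) := by
  obtain ⟨B, hBc, hB, hBU⟩ := h
  refine ⟨(fun V => Subtype.val ⁻¹' V) '' B, hBc.image _, ?_, fun U hU ⟨y, hy⟩ => ?_⟩
  · rintro _ ⟨V, hV, rfl⟩
    obtain ⟨v, hv⟩ := (hB V hV).2
    exact ⟨(hB V hV).1.preimage continuous_subtype_val, ⟨v, mem_univ v⟩, hv⟩
  · obtain ⟨V, hV, hVU⟩ := hBU (Subtype.val '' U) (isOpen_univ.isOpenMap_subtype_val U hU)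
      ⟨y, y, hy, rfl⟩
    refine ⟨_, mem_image_of_mem _ hV, fun z hz => ?_⟩
    obtain ⟨w, hw, hwz⟩ := hVU hz
    rwa [← Subtype.ext hwz]

end PiBase

/-! ### C-compact sets and countable separation -/

section CCompact

variable {X : Type*} [TopologicalSpace X]

/-- A set of reals at each point `p` of whose complement `1 / (y - p)` is bounded is closed. -/
theorem isClosed_of_forall_bounded_inv {S : Set ℝ}
    (h : ∀ p ∉ S, ∃ C : ℝ, ∀ y ∈ S, |(y - p)⁻¹| ≤ C) : IsClosed S := by
  refine isClosed_of_closure_subset fun p hp => ?_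
  by_contra hpS
  obtain ⟨C, hC⟩ := h p hpS
  obtain ⟨y, hy, hyp⟩ := Metric.mem_closure_iff.1 hp (|C| + 1)⁻¹ (by positivity)
  have hne : 0 < |y - p| := abs_pos.2 (sub_ne_zero.2 fun h => hpS (h ▸ hy))
  have h1 := hC y hy
  rw [dist_comm, Real.dist_eq] at hyp
  have h2 : |C| + 1 < |y - p|⁻¹ := (lt_inv_comm₀ hne (by positivity)).1 hyp
  rw [abs_inv] at h1
  linarith [le_abs_self C]

/-- For p outside f(A), the function 1/(f - p) is continuous on A, though perhaps not on X; its
boundedness keeps f(A) away from p. -/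
theorem IsPseudocompactSet.isCCompactSet {A : Set X} (hA : IsPseudocompactSet A) :
    IsCCompactSet A := by
  intro f
  refine Metric.isCompact_of_isClosed_isBounded (isClosed_of_forall_bounded_inv fun p hp => ?_) ?_
  · have hne : ∀ a : A, f a - p ≠ 0 := fun a h => hp ⟨a, a.2, sub_eq_zero.1 h⟩
    obtain ⟨C, hC⟩ := (hA ⟨fun a : A => (f a - p)⁻¹,
      Continuous.inv₀ (by fun_prop) hne⟩).exists_norm_le
    refine ⟨C, ?_⟩
    rintro _ ⟨a, ha, rfl⟩
    exact hC _ ⟨⟨a, ha⟩, rfl⟩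
  · convert hA (f.restrict A) using 1
    ext y
    simp

theorem IsCountablyCompact.isCompact_image_real {A : Set X} (hA : IsCountablyCompact A)
    (f : C(X, ℝ)) : IsCompact (f '' A) :=
  (hA.image f.continuous).isCompact

/-- Images of `C`-compact sets in countable powers of the line are compact. -/
theorem IsCCompactSet.isCompact_image_pi {ι : Type*} [Countable ι] {A : Set X}
    (hA : IsCCompactSet A) (e : ι → C(X, ℝ)) : IsCompact ((fun x i => e i x) '' A) := by
  let : MetricSpace (ι → ℝ) := metrizableSpaceMetric (ι → ℝ)
  have hc : Continuous fun x i => e i x := continuous_pi fun i => (e i).continuous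
  refine (isCompact_univ_pi fun i => hA (e i)).of_isClosed_subset ?_ ?_
  · refine isClosed_of_closure_subset fun p hp => ?_
    -- The distance to p is a single real function on X, so C-compactness makes its infimum 0 over A
    -- attained.
    let d : C(X, ℝ) := ⟨fun x => dist p fun i => e i x, continuous_const.dist hc⟩
    have h0 : (0 : ℝ) ∈ closure (d '' A) := by
      refine Metric.mem_closure_iff.2 fun ε hε => ?_
      obtain ⟨_, ⟨a, ha, rfl⟩, hlt⟩ := Metric.mem_closure_iff.1 hp ε hε
      refine ⟨d a, mem_image_of_mem d ha, ?_⟩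
      rw [Real.dist_eq, zero_sub, abs_neg]
      exact (abs_of_nonneg dist_nonneg).trans_lt hlt
    rw [(hA d).isClosed.closure_eq] at h0
    obtain ⟨a, ha, h⟩ := h0
    exact ⟨a, ha, (dist_eq_zero.1 h).symm⟩
  · rintro _ ⟨a, ha, rfl⟩ i -
    exact mem_image_of_mem _ ha

theorem exists_continuous_eq_zero_eqOn_one [CompletelyRegularSpace X] {x : X} {K : Set X}
    (hK : IsClosed K) (hx : x ∉ K) : ∃ f : C(X, ℝ), f x = 0 ∧ EqOn f 1 K := by
  obtain ⟨f, hf, hf0, hf1⟩ := CompletelyRegularSpace.completely_regular x K hK hx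
  refine ⟨⟨fun y => f y, continuous_subtype_val.comp hf⟩, ?_, fun y hy => ?_⟩
  · simp [hf0]
  · simp [hf1 hy]

/-- A countable family of continuous functions separates the points of `X`. -/
def HasCountableSeparatingFunctions (X : Type*) [TopologicalSpace X] : Prop :=
  ∃ S : Set C(X, ℝ), S.Countable ∧ ∀ x y : X, (∀ f ∈ S, f x = f y) → x = y

theorem IsCCompactSet.isCompact [CompletelyRegularSpace X]
    (hS : HasCountableSeparatingFunctions X) {A : Set X} (hA : IsCCompactSet A) :
    IsCompact A := by
  obtain ⟨S, hSc, hS⟩ := hS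
  have := hSc.to_subtype
  refine isCompact_iff_ultrafilter_le_nhds.2 fun u hu => ?_
  -- The limit point b may depend on g; separation by S later forces all these points to be equal.
  have key : ∀ g : C(X, ℝ), ∃ b ∈ A, (∀ f ∈ S, Tendsto f u (𝓝 (f b))) ∧
      Tendsto g u (𝓝 (g b)) := by
    intro g
    let e : Option S → C(X, ℝ) := fun o => o.elim g Subtype.val
    obtain ⟨_, ⟨b, hb, rfl⟩, hle⟩ := isCompact_iff_ultrafilter_le_nhds.1
      (hA.isCompact_image_pi e) (u.map fun x i => e i x)
      (by
        rw [Ultrafilter.coe_map, ← map_principal]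
        exact map_mono hu)
    have ht : Tendsto (fun x i => e i x) u (𝓝 fun i => e i b) := hle
    rw [tendsto_pi_nhds] at ht
    exact ⟨b, hb, fun f hf => ht (some ⟨f, hf⟩), ht none⟩
  obtain ⟨a, ha, hSa, -⟩ := key 0
  refine ⟨a, ha, fun U hU => ?_⟩
  obtain ⟨g, hg0, hg1⟩ := exists_continuous_eq_zero_eqOn_one (x := a)
    (isOpen_interior (s := U)).isClosed_compl
    (fun h => h (mem_interior_iff_mem_nhds.2 hU))
  obtain ⟨b, -, hSb, hgb⟩ := key g
  obtain rfl : a = b := hS a b fun f hf => tendsto_nhds_unique (hSa f hf) (hSb f hf)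
  rw [hg0] at hgb
  filter_upwards [hgb.eventually_lt_const one_pos] with x hx
  by_contra hxU
  have := hg1 (fun h => hxU (interior_subset h) : x ∈ (interior U)ᶜ)
  simp_all

theorem IsCompact.metrizableSpace_of_separating (hS : HasCountableSeparatingFunctions X)
    {A : Set X} (hA : IsCompact A) : MetrizableSpace A := by
  obtain ⟨S, hSc, hS⟩ := hS
  have := hSc.to_subtype
  have := isCompact_iff_compactSpace.1 hA
  have hc : Continuous fun (x : A) (f : S) => f.1 x :=
    continuous_pi fun f => f.1.continuous.comp continuous_subtype_val
  refine (hc.isClosedEmbedding fun x y hxy => Subtype.ext (hS x y fun f hf => ?_)).metrizableSpace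
  exact congrFun hxy ⟨f, hf⟩

end CCompact

/-! ### Comparison of the six families -/

section Families

variable {X : Type*} [TopologicalSpace X]

theorem familyMC_subset_familySC : familyMC X ⊆ familySC X := by
  rintro A ⟨hne, hA, hm⟩
  have := isCompact_iff_compactSpace.1 hA
  refine ⟨hne, ?_⟩
  have h := (isCompact_univ (X := A)).isSeqCompact.image continuous_subtype_val.seqContinuous
  rwa [image_univ, Subtype.range_coe] at h

theorem familyK_subset_familyCC : familyK X ⊆ familyCC X :=
  fun _ hA => ⟨hA.1, hA.2.isCountablyCompact⟩

theorem familyK_subset_familyPS : familyK X ⊆ familyPS X := fun A hA => by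
  have := isCompact_iff_compactSpace.1 hA.2
  exact ⟨hA.1, fun f => (isCompact_range f.continuous).isBounded⟩

theorem familyMC_subset_familyK : familyMC X ⊆ familyK X := fun _ hA => ⟨hA.1, hA.2.1⟩

theorem familyPS_subset_familyRC : familyPS X ⊆ familyRC X :=
  fun _ hA => ⟨hA.1, hA.2.isCCompactSet⟩

theorem familyCC_subset_familyRC : familyCC X ⊆ familyRC X :=
  fun _ hA => ⟨hA.1, hA.2.isCompact_image_real⟩

theorem familySC_subset_familyRC : familySC X ⊆ familyRC X :=
  fun _ hA => ⟨hA.1, fun f => (hA.2.image f.continuous.seqContinuous).isCompact⟩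

theorem familyK_subset_familyRC : familyK X ⊆ familyRC X :=
  fun _ hA => ⟨hA.1, fun f => hA.2.image f.continuous⟩

theorem family_bounds {lam : Set (Set X)}
    (hlam : lam ∈ ({familyMC X, familyK X, familySC X, familyCC X, familyPS X, familyRC X} :
      Set (Set (Set X)))) : familyMC X ⊆ lam ∧ lam ⊆ familyRC X := by
  have hMK := familyMC_subset_familyK (X := X)
  have hKR := familyK_subset_familyRC (X := X)
  rcases hlam with rfl | rfl | rfl | rfl | rfl | rfl
  · exact ⟨Subset.rfl, hMK.trans hKR⟩
  · exact ⟨hMK, hKR⟩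
  · exact ⟨familyMC_subset_familySC, familySC_subset_familyRC⟩
  · exact ⟨hMK.trans familyK_subset_familyCC, familyCC_subset_familyRC⟩
  · exact ⟨hMK.trans familyK_subset_familyPS, familyPS_subset_familyRC⟩
  · exact ⟨hMK.trans hKR, Subset.rfl⟩

theorem singleton_mem_familyMC (x : X) : {x} ∈ familyMC X := by
  refine ⟨singleton_nonempty x, isCompact_singleton, ?_⟩
  have : DiscreteTopology ({x} : Set X) := Subsingleton.discreteTopology
  infer_instance

/-- When countably many continuous functions separate points, all families between `MC(X)` and
`RC(X)` coincide with `K(X)`. -/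
theorem eq_familyK_of_separating [CompletelyRegularSpace X]
    (hS : HasCountableSeparatingFunctions X) {lam : Set (Set X)} (hMC : familyMC X ⊆ lam)
    (hRC : lam ⊆ familyRC X) : lam = familyK X :=
  Subset.antisymm (fun _ hA => ⟨(hRC hA).1, (hRC hA).2.isCompact hS⟩)
    fun _ hA => hMC ⟨hA.1, hA.2, hA.2.metrizableSpace_of_separating hS⟩

end Families

/-! ### From a countable π-base to the structure of X -/

section PiBaseToX

variable {X : Type*} [TopologicalSpace X]

theorem HasCountablePiBase.hasCountableSeparatingFunctions [T35Space X] {lam : Set (Set X)}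
    (hpt : ∀ x : X, {x} ∈ lam) (h : HasCountablePiBase (SetOpenFun X lam)) :
    HasCountableSeparatingFunctions X := by
  obtain ⟨B, hBc, hB, hBU⟩ := h
  have : Nonempty (SetOpenFun X lam) := ⟨SetOpenFun.of lam 0⟩
  choose! f hf using fun V (hV : V ∈ B) => (hB V hV).2
  refine ⟨(fun V => (SetOpenFun.of lam).symm (f V)) '' B, hBc.image _, fun x y hxy => ?_⟩
  by_contra hne
  obtain ⟨g, hg0, hg1⟩ := exists_continuous_eq_zero_eqOn_one (x := x) (isClosed_singleton (x := y))
    hne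
  obtain ⟨V, hV, hVU⟩ := hBU
    (subbasicSet lam {x} (Iio (1 / 2)) ∩ subbasicSet lam {y} (Ioi (1 / 2)))
    ((isOpen_subbasicSet (hpt x) isOpen_Iio).inter (isOpen_subbasicSet (hpt y) isOpen_Ioi))
    ⟨SetOpenFun.of lam g, of_mem_subbasicSet.2 (by simp [hg0]),
      of_mem_subbasicSet.2 (by have := hg1 rfl; norm_num [this])⟩
  have hfV := hVU (hf V hV)
  obtain ⟨k, hk⟩ := (SetOpenFun.of lam).surjective (f V)
  have hk' := hxy _ (mem_image_of_mem _ hV)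
  rw [← hk] at hfV hk'
  have h1 := of_mem_subbasicSet.1 hfV.1 x rfl
  have h2 := of_mem_subbasicSet.1 hfV.2 y rfl
  simp only [Equiv.symm_apply_apply, mem_Iio, mem_Ioi] at h1 h2 hk'
  linarith

/-- Serves to get normality: a σ-compact regular space is Lindelöf, hence normal, and Urysohn's
lemma applies. -/
theorem IsHemicompact.sigmaCompactSpace (h : IsHemicompact X) : SigmaCompactSpace X := by
  obtain ⟨K, hK, hC⟩ := h
  refine SigmaCompactSpace_iff_exists_compact_covering.2 ⟨K, hK, eq_univ_of_forall fun x => ?_⟩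
  obtain ⟨n, hn⟩ := hC {x} isCompact_singleton
  exact mem_iUnion.2 ⟨n, hn rfl⟩

theorem HasCountablePiBase.isHemicompact [T35Space X]
    (h : HasCountablePiBase (SetOpenFun X (familyK X))) : IsHemicompact X := by
  obtain ⟨B, hBc, hB, hBU⟩ := h
  have : ∀ V ∈ B, ∃ (f : C(X, ℝ)) (K : Set X), IsCompact K ∧
      ∀ g : C(X, ℝ), EqOn g f K → SetOpenFun.of (familyK X) g ∈ V := by
    intro V hV
    obtain ⟨f, hf⟩ := (hB V hV).2
    obtain ⟨K, hK⟩ := exists_compact_support (fun F hF => hF.2) (hB V hV).1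
      ((SetOpenFun.of _).symm f) (by simpa using hf)
    exact ⟨_, K, hK⟩
  choose! f K hKc hK using this
  have hsub : ∀ C : Set X, IsCompact C → ∃ V ∈ B, C ⊆ K V := by
    intro C hC
    rcases C.eq_empty_or_nonempty with rfl | hne
    · obtain ⟨V, hV, -⟩ := hBU univ isOpen_univ ⟨SetOpenFun.of _ 0, mem_univ _⟩
      exact ⟨V, hV, empty_subset _⟩
    obtain ⟨V, hV, hVU⟩ := hBU (subbasicSet (familyK X) C (Iio 1))
      (isOpen_subbasicSet (lam := familyK X) ⟨hne, hC⟩ isOpen_Iio)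
      ⟨SetOpenFun.of _ 0, of_mem_subbasicSet.2 (by simp)⟩
    refine ⟨V, hV, fun x hx => ?_⟩
    by_contra hxK
    obtain ⟨g, hg0, hg1⟩ := exists_continuous_eq_zero_eqOn_one (hKc V hV).isClosed hxK
    -- This function agrees with `f V` on `K V`, hence lies in V, yet takes the forbidden value 1 at
    -- x.
    have hmem := hVU (hK V hV (f V + (1 - f V x) • (1 - g)) fun y hy => by simp [hg1 hy])
    have := of_mem_subbasicSet.1 hmem x hx
    simp [hg0] at this
  obtain ⟨V₀, hV₀, -⟩ := hsub ∅ isCompact_empty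
  obtain ⟨s, rfl⟩ := hBc.exists_eq_range ⟨V₀, hV₀⟩
  refine ⟨fun n => K (s n), fun n => hKc _ (mem_range_self n), fun C hC => ?_⟩
  obtain ⟨_, ⟨n, rfl⟩, hn⟩ := hsub C hC
  exact ⟨n, hn⟩

theorem HasCountablePiBase.isAlephZeroSpace [T35Space X]
    (h : HasCountablePiBase (SetOpenFun X (familyK X))) : IsAlephZeroSpace X := by
  have hX := h.isHemicompact
  have := hX.sigmaCompactSpace
  obtain ⟨K, hKc, hK⟩ := hX
  obtain ⟨B, hBc, hB, hBU⟩ := h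
  -- If all functions in V are positive on C and negative on `K n \ U`, then `P V ∩ K n` lies
  -- between C and U.
  let P : Set (SetOpenFun X (familyK X)) → Set X := fun V =>
    {x | ∀ f : C(X, ℝ), SetOpenFun.of _ f ∈ V → 0 < f x}
  refine ⟨inferInstance, image2 (fun V n => P V ∩ K n) B univ, hBc.image2 countable_univ _,
    fun C U hC hU hCU => ?_⟩
  rcases C.eq_empty_or_nonempty with rfl | hne
  · exact ⟨∅, empty_subset _, finite_empty, by simp, by simp⟩
  obtain ⟨n, hn⟩ := hK C hC
  obtain ⟨g, hg0, hg1, -⟩ := exists_continuous_zero_one_of_isClosed hU.isClosed_compl hC.isClosed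
    (disjoint_compl_left_iff_subset.2 hCU)
  have hW : ∃ V ∈ B, ∀ f : C(X, ℝ), SetOpenFun.of (familyK X) f ∈ V →
      (∀ x ∈ C, 0 < f x) ∧ ∀ x ∈ K n \ U, f x < 0 := by
    have hCo := isOpen_subbasicSet (lam := familyK X) ⟨hne, hC⟩ (isOpen_Ioi (a := (0 : ℝ)))
    have hgC : SetOpenFun.of (familyK X) (g - ContinuousMap.const X (1 / 2)) ∈
        subbasicSet (familyK X) C (Ioi 0) :=
      of_mem_subbasicSet.2 fun x hx => by norm_num [hg1 hx]
    rcases (K n \ U).eq_empty_or_nonempty with he | hne'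
    · obtain ⟨V, hV, hVU⟩ := hBU _ hCo ⟨_, hgC⟩
      exact ⟨V, hV, fun f hf => ⟨of_mem_subbasicSet.1 (hVU hf), by simp [he]⟩⟩
    · obtain ⟨V, hV, hVU⟩ := hBU (_ ∩ subbasicSet (familyK X) (K n \ U) (Iio 0))
        (hCo.inter (isOpen_subbasicSet (lam := familyK X) ⟨hne', (hKc n).diff hU⟩ isOpen_Iio))
        ⟨_, hgC, of_mem_subbasicSet.2 fun x hx => by
          have : g x = 0 := hg0 hx.2
          norm_num [this]⟩
      exact ⟨V, hV, fun f hf => ⟨of_mem_subbasicSet.1 (hVU hf).1, of_mem_subbasicSet.1 (hVU hf).2⟩⟩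
  obtain ⟨V, hV, hVf⟩ := hW
  refine ⟨{P V ∩ K n}, singleton_subset_iff.2 (mem_image2_of_mem hV (mem_univ n)),
    finite_singleton _, ?_, ?_⟩
  · rw [sUnion_singleton]
    exact fun x hx => ⟨fun f hf => (hVf f hf).1 x hx, hn hx⟩
  · rw [sUnion_singleton]
    rintro x ⟨hxP, hxK⟩
    by_contra hxU
    obtain ⟨f, hf⟩ := (hB V hV).2
    obtain ⟨f, rfl⟩ := (SetOpenFun.of (familyK X)).surjective f
    exact lt_asymm (hxP f hf) ((hVf f hf).2 x ⟨hxK, hxU⟩)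

end PiBaseToX

/-! ### From a hemicompact ℵ₀-space to second countability -/

section XToSecondCountable

variable {X : Type*} [TopologicalSpace X]

theorem IsKNetwork.exists_mem_subset {N : Set (Set X)} (hN : IsKNetwork N) {x : X} {U : Set X}
    (hU : U ∈ 𝓝 x) : ∃ A ∈ N, x ∈ A ∧ A ⊆ U := by
  obtain ⟨F, hFN, -, hxF, hFU⟩ := hN {x} (interior U) isCompact_singleton isOpen_interior
    (singleton_subset_iff.2 (mem_interior_iff_mem_nhds.2 hU))
  obtain ⟨A, hA, hxA⟩ := hxF rfl
  exact ⟨A, hFN hA, hxA, (subset_sUnion_of_mem hA).trans (hFU.trans interior_subset)⟩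

/-- Distinct points have disjoint closed neighbourhoods, each containing a network member around its
point; the closures of these two members stay disjoint. -/
theorem IsAlephZeroSpace.hasCountableSeparatingFunctions [NormalSpace X]
    (h : IsAlephZeroSpace X) : HasCountableSeparatingFunctions X := by
  obtain ⟨hT3, N, hNc, hN⟩ := h
  have hex : ∀ A B : Set X, ∃ f : C(X, ℝ), Disjoint (closure A) (closure B) →
      EqOn f 0 (closure A) ∧ EqOn f 1 (closure B) := by
    intro A B
    by_cases hAB : Disjoint (closure A) (closure B)
    · obtain ⟨f, h0, h1, -⟩ :=
        exists_continuous_zero_one_of_isClosed isClosed_closure isClosed_closure hAB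
      exact ⟨f, fun _ => ⟨h0, h1⟩⟩
    · exact ⟨0, fun h => absurd h hAB⟩
  choose f hf using hex
  refine ⟨image2 f N N, hNc.image2 hNc f, fun x y hxy => ?_⟩
  by_contra hne
  obtain ⟨u, hu, huc, v, hv, hvc, huv⟩ : ∃ u ∈ 𝓝 x, IsClosed u ∧ ∃ v ∈ 𝓝 y, IsClosed v ∧
      Disjoint u v := by
    obtain ⟨u, ⟨hu, huc⟩, v, ⟨hv, hvc⟩, huv⟩ :=
      ((closed_nhds_basis x).disjoint_iff (closed_nhds_basis y)).1 (disjoint_nhds_nhds.2 hne)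
    exact ⟨u, hu, huc, v, hv, hvc, huv⟩
  obtain ⟨A, hA, hxA, hAu⟩ := hN.exists_mem_subset hu
  obtain ⟨B, hB, hyB, hBv⟩ := hN.exists_mem_subset hv
  obtain ⟨h0, h1⟩ := hf A B
    (huv.mono (closure_minimal hAu huc) (closure_minimal hBv hvc))
  have := hxy _ (mem_image2_of_mem hA hB)
  rw [h0 (subset_closure hxA), h1 (subset_closure hyB)] at this
  simp at this

theorem IsHemicompact.secondCountable_setOpenFun (hX : IsHemicompact X)
    (hm : ∀ A : Set X, IsCompact A → MetrizableSpace A) :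
    SecondCountableTopology (SetOpenFun X (familyK X)) := by
  obtain ⟨K, hKc, hK⟩ := hX
  have : ∀ n, CompactSpace (K n) := fun n => isCompact_iff_compactSpace.1 (hKc n)
  have : ∀ n, MetrizableSpace (K n) := fun n => hm _ (hKc n)
  have : ∀ n, SecondCountableTopology (K n) := fun n => by
    let := metrizableSpaceMetric (K n)
    infer_instance
  let r : SetOpenFun X (familyK X) → ∀ n, C(K n, ℝ) := fun f n =>
    ((SetOpenFun.of _).symm f).restrict (K n)
  -- Hemicompactness is what makes restrictions to the `K n` suffice: each compact F lies in one of
  -- them.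
  have hr : IsInducing r := by
    refine ⟨le_antisymm ?_ ?_⟩
    · rw [← continuous_iff_le_induced]
      refine continuous_pi fun n => ContinuousMap.continuous_compactOpen.2 fun C hC U hU => ?_
      rcases C.eq_empty_or_nonempty with rfl | hne
      · convert isOpen_univ using 1
        exact eq_univ_of_forall fun f => mapsTo_empty _ _
      · convert isOpen_subbasicSet (lam := familyK X) (F := Subtype.val '' C)
          ⟨hne.image _, hC.image continuous_subtype_val⟩ hU using 1
        ext f
        obtain ⟨f, rfl⟩ := (SetOpenFun.of (familyK X)).surjective f
        simp only [mem_ofPred_eq, of_mem_subbasicSet, forall_mem_image]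
        rfl
    · refine le_generateFrom ?_
      rintro _ ⟨F, hF, U, hU, rfl⟩
      obtain ⟨n, hn⟩ := hK F hF.2
      have hF' : IsCompact (Subtype.val ⁻¹' F : Set (K n)) := by
        rw [Subtype.isCompact_iff, Subtype.image_preimage_coe, inter_eq_self_of_subset_right hn]
        exact hF.2
      refine isOpen_induced_iff.2 ⟨(fun g => g n) ⁻¹' {g | MapsTo g (Subtype.val ⁻¹' F) U},
        (ContinuousMap.isOpen_setOfPred_mapsTo hF' hU).preimage (continuous_apply n), ?_⟩
      ext f
      obtain ⟨f, rfl⟩ := (SetOpenFun.of (familyK X)).surjective f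
      rw [of_mem_subbasicSet]
      exact ⟨fun h x hx => h (show (⟨x, hn hx⟩ : K n) ∈ _ from hx), fun h x hx => h x hx⟩
  exact hr.secondCountableTopology

end XToSecondCountable

theorem mainTheorem11 {X : Type*} [TopologicalSpace X] [T35Space X] (lam : Set (Set X))
    (hlam : lam ∈ ({familyMC X, familyK X, familySC X, familyCC X, familyPS X, familyRC X} :
      Set (Set (Set X)))) :
    List.TFAE [
      ∃ D : Set (SetOpenFun X lam), Dense D ∧ HasCountablePiBase D,
      HasCountablePiBase (SetOpenFun X lam),
      SecondCountableTopology (SetOpenFun X lam),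
      IsHemicompact X ∧ IsAlephZeroSpace X] := by
  obtain ⟨hMC, hRC⟩ := family_bounds hlam
  clear hlam
  have hpt : ∀ x : X, {x} ∈ lam := fun x => hMC (singleton_mem_familyMC x)
  tfae_have 1 → 2 := by
    rintro ⟨D, hD, h⟩
    have := regularSpace_setOpenFun hpt hRC
    exact h.of_dense hD
  tfae_have 2 → 1 := fun h => ⟨univ, dense_univ, h.restrict_univ⟩
  tfae_have 3 → 2 := fun _ => .of_secondCountable
  tfae_have 2 → 4 := by
    intro h
    obtain rfl := eq_familyK_of_separating (h.hasCountableSeparatingFunctions hpt) hMC hRC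
    exact ⟨h.isHemicompact, h.isAlephZeroSpace⟩
  tfae_have 4 → 3 := by
    rintro ⟨hX, hA⟩
    have := hX.sigmaCompactSpace
    have hS := hA.hasCountableSeparatingFunctions
    obtain rfl := eq_familyK_of_separating hS hMC hRC
    exact hX.secondCountable_setOpenFun fun A hA => hA.metrizableSpace_of_separating hS
  tfae_finish
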